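/- Let $e$ be an odd positive integer, $q=2^e$ and $r\ge 3$. Let $\varepsilon\in\mathbb F_{q^2}\setminus\mathbb F_q$ be such that $\varepsilon^2+\varepsilon+\delta=0$ for some $\delta\in\mathbb F_q\setminus\{1\}$ with $\mathrm{Tr}_{\mathbb F_q/\mathbb F_2}(\delta)=1$, and let $\sigma$ be the map $x\mapsto x^{2^{(e+1)/2}}$. Put $$\Gamma_\varepsilon(x)=[x+(x^q+x)\varepsilon]^{\sigma+2}+(x^q+x)^\sigma+(x^{2q}+x^2)\varepsilon+x^{q+1}+x^2 ,$$ where $y^{\sigma+2}=y^\sigma y^2$. In $\mathrm{PG}(r,q^2)$ with homogeneous coordinates $(X_0,\dots,X_r)$, let $\Pi_\infty$ be the hyperplane $X_0=0$, let $P_\infty=(0,\dots,0,1)$, and let $\mathcal V^r_\varepsilon$ be the projective variety with affine equation (where $x_i=X_i/X_0$) $$x_r^q+x_r=\Gamma_\varepsilon(x_1)+\cdots+\Gamma_\varepsilon(x_{r-1}).$$ For an integer $j\ge 1$ let $\overline{\mathcal V^r_\varepsilon}$ be the multiset consisting of the points of $\mathcal V^r_\varepsilon\setminus\Pi_\infty$,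 each with multiplicity one, together with $P_\infty$ with multiplicity $j$. Let $\mathcal C$ be a linear code over $\mathbb F_{q^2}$ generated by $\overline{\mathcal V^r_\varepsilon}$, i.e. the row space of a matrix with $r+1$ rows whose columns are coordinate vectors of the points of $\overline{\mathcal V^r_\varepsilon}$, listed with multiplicity. Then $\mathcal C$ has length $q^{2r-1}+j$ and dimension $r+1$, and the set of Hamming weights of its nonzero codewords is exactly the set consisting of $$q^{2r-1},\qquad q^{2r-1}-q^{2r-3},\qquad q^{2r-1}-q^{2r-3}+(-1)^{r-1}q^{r-2}+j,$$ $$q^{2r-1}-q^{2r-3}+(-1)^{r-1}q^{r-2}-(-1)^{r-1}q^{r-1}+j .$$ Furthermore, the nonzero codewords of $\mathcal C$ have exactly three distinct weights in each of the following cases: (i) $r$ is odd and $j=q^{r-1}-q^{r-2}$, or $j=q^{2r-3}-q^{r-2}$, or $j=q^{2r-3}+q^{r-1}-q^{r-2}$; (ii) $r$ is even and $j=q^{r-2}$, or $j=q^{2r-3}+q^{r-2}$, or $j=q^{2r-3}-q^{r-1}+q^{r-2}$. -/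

import Mathlib

namespace BTCode

section Geometry

variable {K : Type*} [Field K]

/-- The homogenization, with respect to `X₀`, of a polynomial `f` in the affine coordinates
`x₁, …, x_r` (written as the variables `X 1, …, X r`): the monomial `x^m` of `f` becomes
`X₀ ^ (deg f - |m|) * X^m`. -/
noncomputable def homogenization {r : ℕ} (f : MvPolynomial (Fin (r + 1)) K) :
    MvPolynomial (Fin (r + 1)) K :=
  ∑ m ∈ f.support,
    MvPolynomial.monomial (m + Finsupp.single 0 (f.totalDegree - m.degree)) (f.coeff m)

theorem homogenization_isHomogeneous {r : ℕ} (f : MvPolynomial (Fin (r + 1)) K) :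
    (homogenization f).IsHomogeneous f.totalDegree := by
  refine MvPolynomial.IsHomogeneous.sum _ _ _ fun m hm => ?_
  apply MvPolynomial.isHomogeneous_monomial
  have h : m.degree ≤ f.totalDegree := by
    rw [Finsupp.degree_eq_sum]
    have := MvPolynomial.le_totalDegree hm
    rwa [Finsupp.sum_fintype _ _ (by simp)] at this
  rw [map_add, Finsupp.degree_single]
  omega

/-- At a point with `X₀ ≠ 0` the homogenization is, up to a nonzero factor, the value of the
affine polynomial at the affine coordinates `x_i = X_i / X₀`. -/
theorem eval_homogenization {r : ℕ} (f : MvPolynomial (Fin (r + 1)) K) (v : Fin (r + 1) → K)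
    (hv : v 0 ≠ 0) :
    MvPolynomial.eval v (homogenization f) =
      v 0 ^ f.totalDegree * MvPolynomial.eval (fun i => v i / v 0) f := by
  rw [homogenization, map_sum, MvPolynomial.eval_eq', Finset.mul_sum]
  refine Finset.sum_congr rfl fun m hm => ?_
  have h : m.degree ≤ f.totalDegree := by
    rw [Finsupp.degree_eq_sum]
    have := MvPolynomial.le_totalDegree hm
    rwa [Finsupp.sum_fintype _ _ (by simp)] at this
  rw [MvPolynomial.eval_monomial, Finsupp.prod_fintype _ _ (by simp)]
  simp only [Finsupp.add_apply, pow_add, Finset.prod_mul_distrib, div_pow, Finset.prod_div_distrib]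
  have h1 : ∏ i, v i ^ (Finsupp.single (0 : Fin (r + 1)) (f.totalDegree - m.degree)) i
      = v 0 ^ (f.totalDegree - m.degree) := by
    rw [Finset.prod_eq_single 0]
    · simp
    · intro b _ hb
      simp [hb.symm]
    · simp
  have h2 : ∏ i, v 0 ^ m i = v 0 ^ m.degree := by
    rw [Finset.prod_pow_eq_pow_sum, Finsupp.degree_eq_sum]
  rw [h1, h2]
  have h3 : v 0 ^ f.totalDegree = v 0 ^ (f.totalDegree - m.degree) * v 0 ^ m.degree := by
    rw [← pow_add, Nat.sub_add_cancel h]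
  rw [h3]
  have := pow_ne_zero m.degree hv
  field_simp

/-- The set of `K`-rational points of `PG(r, K)` on the projective variety with affine
equation `f = 0`. -/
def projectiveVariety {r : ℕ} (f : MvPolynomial (Fin (r + 1)) K) :
    Set (Projectivization K (Fin (r + 1) → K)) :=
  {P | MvPolynomial.eval P.rep (homogenization f) = 0}

theorem mk_mem_projectiveVariety {r : ℕ} (f : MvPolynomial (Fin (r + 1)) K)
    (v : Fin (r + 1) → K) (hv : v ≠ 0) :
    Projectivization.mk K v hv ∈ projectiveVariety f ↔
      MvPolynomial.eval v (homogenization f) = 0 := by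
  obtain ⟨a, ha⟩ := Projectivization.exists_smul_eq_mk_rep K v hv
  have hs : (Projectivization.mk K v hv).rep = fun i => (a : K) * v i := by
    rw [← ha]; rfl
  have key : MvPolynomial.eval (fun i => (a : K) * v i) (homogenization f)
      = (a : K) ^ f.totalDegree * MvPolynomial.eval v (homogenization f) := by
    rw [MvPolynomial.eval_eq', MvPolynomial.eval_eq', Finset.mul_sum]
    refine Finset.sum_congr rfl fun m hm => ?_
    have hd : m.degree = f.totalDegree := by
      have := homogenization_isHomogeneous f (MvPolynomial.mem_support_iff.mp hm)
      rw [Finsupp.degree_eq_weight_one]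
      exact this
    simp only [mul_pow, Finset.prod_mul_distrib]
    rw [Finset.prod_pow_eq_pow_sum, ← hd, Finsupp.degree_eq_sum]
    ring
  rw [projectiveVariety, Set.mem_ofPred_eq, hs, key, mul_eq_zero]
  simp

/-- The hyperplane at infinity `X₀ = 0` of `PG(r, K)`. -/
def hyperplaneAtInfinity (K : Type*) [Field K] (r : ℕ) :
    Set (Projectivization K (Fin (r + 1) → K)) :=
  {P | P.rep 0 = 0}

theorem mk_mem_hyperplaneAtInfinity {r : ℕ} (v : Fin (r + 1) → K) (hv : v ≠ 0) :
    Projectivization.mk K v hv ∈ hyperplaneAtInfinity K r ↔ v 0 = 0 := by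
  obtain ⟨a, ha⟩ := Projectivization.exists_smul_eq_mk_rep K v hv
  rw [hyperplaneAtInfinity, Set.mem_ofPred_eq, ← ha]
  change (a : K) * v 0 = 0 ↔ _
  simp

/-- The point `P_∞ = (0, …, 0, 1)` of `PG(r, K)`. -/
noncomputable def pointAtInfinity (K : Type*) [Field K] (r : ℕ) :
    Projectivization K (Fin (r + 1) → K) :=
  Projectivization.mk K (Pi.single (Fin.last r) 1) (by simp)

/-- With `q = 2 ^ e` and `σ : x ↦ x ^ (2 ^ ((e + 1) / 2))`, the expression
`Γ_ε(x) = [x + (x^q + x) ε]^(σ+2) + (x^q + x)^σ + (x^(2q) + x^2) ε + x^(q+1) + x^2`,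
for `x` in a commutative `K`-algebra. -/
def Gam (e : ℕ) (ε : K) {A : Type*} [CommRing A] [Algebra K A] (x : A) : A :=
  (x + (x ^ 2 ^ e + x) * algebraMap K A ε) ^ (2 ^ ((e + 1) / 2) + 2)
    + (x ^ 2 ^ e + x) ^ 2 ^ ((e + 1) / 2)
    + (x ^ (2 * 2 ^ e) + x ^ 2) * algebraMap K A ε
    + x ^ (2 ^ e + 1) + x ^ 2

/-- The polynomial `x_r^q + x_r - (Γ_ε(x₁) + ⋯ + Γ_ε(x_{r-1}))`, with `q = 2 ^ e`. -/
noncomputable def affineEquation (r e : ℕ) (ε : K) : MvPolynomial (Fin (r + 1)) K :=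
  MvPolynomial.X (Fin.last r) ^ 2 ^ e + MvPolynomial.X (Fin.last r)
    - ∑ i ∈ Finset.Ioo 0 (Fin.last r), Gam e ε (MvPolynomial.X i)

/-- The variety `V_ε^r` (its set of rational points). -/
noncomputable def V (r e : ℕ) (ε : K) : Set (Projectivization K (Fin (r + 1) → K)) :=
  projectiveVariety (affineEquation r e ε)

/-- The affine points `(1, x₁, …, x_r)` of `V_ε^r` are those satisfying the affine equation. -/
theorem mk_mem_V {r e : ℕ} (ε : K) (v : Fin (r + 1) → K) (hv : v ≠ 0) (h0 : v 0 = 1) :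
    Projectivization.mk K v hv ∈ V r e ε ↔
      v (Fin.last r) ^ 2 ^ e + v (Fin.last r) =
        ∑ i ∈ Finset.Ioo 0 (Fin.last r), Gam e ε (v i) := by
  rw [V, mk_mem_projectiveVariety, eval_homogenization _ _ (by simp [h0])]
  simp [h0, affineEquation, Gam, sub_eq_zero, MvPolynomial.algebraMap_eq]

/-- The multiset made of the affine points of `V_ε^r`, each once, and of `P_∞` with
multiplicity `j`. -/
noncomputable def Vbar [Finite K] (r e : ℕ) (ε : K) (j : ℕ) :
    Multiset (Projectivization K (Fin (r + 1) → K)) :=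
  (V r e ε \ hyperplaneAtInfinity K r).toFinite.toFinset.val
    + Multiset.replicate j (pointAtInfinity K r)

end Geometry

section Codes

variable {K : Type*} [Field K]

/-- `C` is a linear code generated by the multiset `Ω` of points of `PG(r, K)`: it is the row
space of a matrix whose columns are coordinate vectors of the points of `Ω`, listed in some
order and with their multiplicities. -/
def IsGeneratedBy {r n : ℕ} (C : Submodule K (Fin n → K))
    (Ω : Multiset (Projectivization K (Fin (r + 1) → K))) : Prop :=
  ∃ (G : Matrix (Fin (r + 1)) (Fin n) K) (hG : ∀ i, G.col i ≠ 0),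
    (Finset.univ.val.map fun i => Projectivization.mk K (G.col i) (hG i)) = Ω ∧
      C = Submodule.span K (Set.range G.row)

/-- Every multiset of points generates a code, of length its cardinality. -/
theorem exists_isGeneratedBy {r : ℕ} (Ω : Multiset (Projectivization K (Fin (r + 1) → K))) :
    ∃ C : Submodule K (Fin (Multiset.card Ω) → K), IsGeneratedBy C Ω := by
  induction Ω using Quotient.inductionOn with
  | _ l =>
    refine ⟨_, Matrix.of fun a (i : Fin l.length) => (l.get i).rep a,
      fun i => (l.get i).rep_nonzero, ?_, rfl⟩
    have h : ∀ i : Fin l.length, Projectivization.mk K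
        ((Matrix.of fun a (i : Fin l.length) => (l.get i).rep a).col i)
          (l.get i).rep_nonzero = l.get i := fun i => (l.get i).mk_rep
    calc _ = Multiset.map (fun i : Fin l.length => l.get i) Finset.univ.val :=
          Multiset.map_congr rfl fun i _ => h i
      _ = _ := by
        rw [Fin.univ_val_map]
        simp

/-- The set of Hamming weights of the nonzero codewords of `C`. -/
def weights {n : ℕ} [DecidableEq K] (C : Submodule K (Fin n → K)) : Set ℕ :=
  {w | ∃ c ∈ C, c ≠ 0 ∧ hammingNorm c = w}

/-- `C` is a `k`-weight code: its nonzero codewords have exactly `k` distinct weights. -/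
def IsWeightCode {n : ℕ} [DecidableEq K] (k : ℕ) (C : Submodule K (Fin n → K)) : Prop :=
  (weights C).ncard = k

end Codes

end BTCode

/-!
Write `x ∈ 𝔽_{q²}` as `x = u + v ε` with `u, v ∈ 𝔽_q`. The Frobenius map over `𝔽_q` sends `ε` to
`ε + 1`, so `x ^ q + x = v`, and the expression `Γ_ε(x)` collapses to the Tits form
`u ^ (σ + 2) + v ^ σ + u v`, an element of `𝔽_q` (`Gam_coordEquiv`). Because `e` is odd, `σ` is an
automorphism of `𝔽_q` whose square is `x ↦ x ^ 2`.

The Tits form vanishes only at the origin, and scaling by `(u, v) ↦ (l u, l ^ (σ + 1) v)` multiplies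
it by `l ^ (σ + 2)`, which runs through all nonzero elements; hence it takes each nonzero value
`q + 1` times (`titsForm_hasEllipticFibres`). Adding a linear function only changes the coordinates
by a shear and the form by a constant (`titsForm_shear`). So `Γ_ε(x) + Tr(a x)` takes one value once
and every other value `q + 1` times, and convolving such distributions over `m` variables gives the
constant function plus `(-q) ^ m` times a point mass (`hasEllipticFibres_sum_pi`).

A codeword is a linear form evaluated on the multiset, so its weight is the length minus the number
of points of the multiset on a hyperplane (`hammingNorm_vecMul`). The hyperplane at infinity has no
affine points of the variety. A hyperplane through `P_∞` is a cylinder over a hyperplane in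
`x₁, …, x_{r-1}`, over each point of which lie `q` points of the variety. A hyperplane
`x_r = c₀ + ∑ cᵢ xᵢ` meets the variety in the solutions of `∑ (Γ_ε(xᵢ) + Tr(cᵢ xᵢ)) = Tr(c₀)`, of
which there are two possible numbers, both attained as `c₀` varies. Since none of the resulting
weights is zero, distinct linear forms give distinct codewords, whence the dimension.
-/

namespace BTCode

/-! ### Fibres of elliptic type -/

section Fibres

variable {F : Type*} {X Y : Type*}

open Classical in
/-- The fibres of `g : X → F` have the sizes of those of an elliptic quadratic form in `2 * m`
variables when `m` is odd, of a hyperbolic one when `m` is even (and `F` has `q` elements): all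
fibres have the same size, up to a correction `(-q) ^ m` at one value `T`. Sizes are multiplied
by `q` to avoid a division. -/
def HasEllipticFibres (q m : ℕ) (g : X → F) : Prop :=
  ∃ T : F, ∀ t : F, (Nat.card {x // g x = t} : ℤ) * q =
    (q : ℤ) ^ (2 * m) - (-(q : ℤ)) ^ m + if t = T then (q : ℤ) * (-(q : ℤ)) ^ m else 0

theorem HasEllipticFibres.comp_equiv {q m : ℕ} {g : X → F} (h : HasEllipticFibres q m g)
    (φ : Y ≃ X) : HasEllipticFibres q m (g ∘ φ) := by
  obtain ⟨T, hT⟩ := h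
  refine ⟨T, fun t => ?_⟩
  rw [← hT t]
  congr 2
  exact Nat.card_congr (φ.subtypeEquiv fun _ => Iff.rfl)

variable [AddCommGroup F]

theorem HasEllipticFibres.add_const {q m : ℕ} {g : X → F} (h : HasEllipticFibres q m g)
    (c : F) : HasEllipticFibres q m (fun x => g x + c) := by
  obtain ⟨T, hT⟩ := h
  refine ⟨T + c, fun t => ?_⟩
  have h := hT (t - c)
  rw [Nat.card_congr (Equiv.subtypeEquivRight fun x => eq_sub_iff_add_eq)] at h
  rw [h]
  congr 1
  classical
  exact if_congr sub_eq_iff_eq_add rfl rfl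

theorem hasEllipticFibres_zero [Unique X] (q : ℕ) (g : X → F) (hg : g default = 0) :
    HasEllipticFibres q 0 g := by
  refine ⟨0, fun t => ?_⟩
  by_cases ht : t = 0
  · have : Nat.card {x // g x = t} = 1 := by
      rw [Nat.card_eq_one_iff_exists]
      exact ⟨⟨default, by rw [hg, ht]⟩, fun y => Subsingleton.elim _ _⟩
    simp [ht ▸ this, ht]
  · have : IsEmpty {x // g x = t} :=
      ⟨fun x => ht (by rw [← x.2, Unique.eq_default x.1, hg])⟩
    simp [ht]

/-- Convolution of fibre sizes: adding a function with `m = 1` in a fresh variable raises `m`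
by one. -/
theorem HasEllipticFibres.sum [Finite X] [Finite Y] {q m : ℕ} (hq : 0 < q) {g : X → F}
    {h : Y → F} (hX : Nat.card X = q ^ (2 * m)) (hg : HasEllipticFibres q m g)
    (hh : HasEllipticFibres q 1 h) :
    HasEllipticFibres q (m + 1) (fun p : Y × X => h p.1 + g p.2) := by
  classical
  have := Fintype.ofFinite X
  obtain ⟨T, hT⟩ := hg
  obtain ⟨S, hS⟩ := hh
  have hq0 : (q : ℤ) ≠ 0 := by exact_mod_cast hq.ne'
  have hS' : ∀ t, (Nat.card {y // h y = t} : ℤ) = q + 1 - if t = S then (q : ℤ) else 0 := by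
    intro t
    apply mul_right_cancel₀ hq0
    rw [hS t]
    split_ifs <;> ring
  refine ⟨T + S, fun t => ?_⟩
  have hE : Nat.card {p : Y × X // h p.1 + g p.2 = t}
      = ∑ x : X, Nat.card {y // h y = t - g x} := by
    rw [← Nat.card_sigma]
    refine Nat.card_congr
      { toFun := fun p => ⟨p.1.2, p.1.1, eq_sub_of_add_eq p.2⟩
        invFun := fun p => ⟨(p.2.1, p.1), by simpa using congrArg (· + g p.1) p.2.2⟩
        left_inv := fun _ => rfl
        right_inv := fun _ => rfl }
  have hind : ∑ x : X, (if t - g x = S then (q : ℤ) else 0)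
      = q * Nat.card {x // g x = t - S} := by
    rw [← Finset.sum_filter, Finset.sum_const, Nat.card_eq_fintype_card, Fintype.card_subtype,
      nsmul_eq_mul, mul_comm]
    congr 3
    ext x
    simp only [Finset.mem_filter, Finset.mem_univ, true_and]
    rw [sub_eq_iff_eq_add, eq_sub_iff_add_eq, eq_comm, add_comm]
  have hX' : (Fintype.card X : ℤ) = (q : ℤ) ^ (2 * m) := by
    rw [← Nat.card_eq_fintype_card, hX]; push_cast; rfl
  have hT' := hT (t - S)
  rw [hE, Nat.cast_sum, Finset.sum_congr rfl fun x _ => hS' (t - g x), Finset.sum_sub_distrib,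
    hind, Finset.sum_const, Finset.card_univ, nsmul_eq_mul, hX', sub_mul, mul_assoc (q : ℤ), hT']
  simp only [sub_eq_iff_eq_add]
  split_ifs <;> ring

theorem hasEllipticFibres_sum_pi [Finite X] {q : ℕ} (hq : 0 < q) (hX : Nat.card X = q ^ 2)
    (m : ℕ) (g : Fin m → X → F) (hg : ∀ i, HasEllipticFibres q 1 (g i)) :
    HasEllipticFibres q m (fun x : Fin m → X => ∑ i, g i (x i)) := by
  induction m with
  | zero => exact hasEllipticFibres_zero q _ (by simp)
  | succ m ih =>
    have h := HasEllipticFibres.sum hq (by rw [Nat.card_fun, hX, Nat.card_fin, ← pow_mul])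
      (ih (fun i => g i.succ) fun i => hg i.succ) (hg 0)
    have h2 := h.comp_equiv (Fin.consEquiv fun _ : Fin (m + 1) => X).symm
    convert h2 using 2 with x
    simp [Fin.sum_univ_succ, Fin.consEquiv, Fin.tail]

end Fibres

/-! ### The Tits form -/

section Tits

variable {F : Type*} [Field F]

/-- The form `x ^ (σ + 2) + y ^ σ + x * y` whose graph is the affine part of the Suzuki-Tits
ovoid. The automorphism `σ` is given by its exponent `s`. -/
def titsForm (s : ℕ) (p : F × F) : F := p.1 ^ (s + 2) + p.2 ^ s + p.1 * p.2

variable {s : ℕ}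

theorem titsForm_scale (hss : ∀ x : F, (x ^ s) ^ s = x ^ 2) (l x y : F) :
    titsForm s (l * x, l ^ (s + 1) * y) = l ^ (s + 2) * titsForm s (x, y) := by
  have : (l ^ (s + 1)) ^ s = l ^ (s + 2) := by
    rw [pow_succ, mul_pow, hss, ← pow_add, add_comm]
  simp only [titsForm, mul_pow, this]
  ring

variable [CharP F 2]

/-- The Suzuki group fixing the point at infinity acts on the ovoid: a shear of the plane changes
the Tits form by an affine function, which can be prescribed up to its constant term. -/
theorem titsForm_shear (hadd : ∀ x y : F, (x + y) ^ s = x ^ s + y ^ s)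
    (hss : ∀ x : F, (x ^ s) ^ s = x ^ 2) (a b x y : F) :
    titsForm s (x + a, y + b + a ^ s * x) =
      titsForm s (x, y) + titsForm s (a, b) + (b + a ^ (s + 1)) * x + a * y := by
  have h2 : (2 : F) = 0 := CharTwo.two_eq_zero
  simp only [titsForm, pow_add, hadd, mul_pow, hss]
  linear_combination (x ^ s * a * x + a ^ s * x * a + a ^ 2 * x ^ s + a ^ s * x ^ 2) * h2

theorem pow_add_two_injective (hss : ∀ x : F, (x ^ s) ^ s = x ^ 2) :
    Function.Injective fun x : F => x ^ (s + 2) := by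
  have key : ∀ x : F, x ^ (s + 2) = 1 → x = 1 := by
    intro x hx
    -- applying `σ` to `x ^ (σ + 2) = 1` gives `x ^ (2 + 2 * σ) = 1`, whence `x ^ 2 = 1`
    have h1 : x ^ 2 * (x ^ s) ^ 2 = 1 := by
      have := congrArg (· ^ s) hx
      simp only [pow_add, mul_pow, hss, one_pow] at this
      rw [← this, pow_right_comm]
    have h2 : x ^ 2 = 1 := by
      have : x ^ 2 * (x ^ 2 * (x ^ s) ^ 2) = (x ^ (s + 2)) ^ 2 := by ring
      rw [h1, hx] at this
      simpa using this
    exact CharTwo.sq_injective (by simpa using h2)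
  intro x y hxy
  simp only at hxy
  by_cases hy : y = 0
  · rw [hy, zero_pow (by omega)] at hxy
    rw [hy, pow_eq_zero_iff (by omega) |>.1 hxy]
  · have := key (x / y) (by rw [div_pow, hxy, div_self (pow_ne_zero _ hy)])
    rwa [div_eq_one_iff_eq hy] at this

theorem titsForm_eq_zero_iff (hs : s ≠ 0) (hadd : ∀ x y : F, (x + y) ^ s = x ^ s + y ^ s)
    (hss : ∀ x : F, (x ^ s) ^ s = x ^ 2) (p : F × F) : titsForm s p = 0 ↔ p = 0 := by
  refine ⟨fun h => ?_, fun h => by simp [h, titsForm, hs]⟩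
  obtain ⟨x, y⟩ := p
  by_cases hx : x = 0
  · simp only [titsForm, hx, zero_mul, add_zero] at h
    rw [zero_pow (by omega), zero_add] at h
    rw [hx, pow_eq_zero_iff hs |>.1 h]; rfl
  · exfalso
    -- after scaling, `x = 1` and `z ^ σ = z + 1`; applying `σ` twice, `z ^ 2 = z`
    obtain ⟨z, hz⟩ : ∃ z, y = x ^ (s + 1) * z := ⟨y / x ^ (s + 1), by field_simp⟩
    have h1 := titsForm_scale hss x 1 z
    rw [mul_one, ← hz, h] at h1
    have h3 : (1 : F) + z ^ s + z = 0 := by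
      have := (mul_eq_zero.1 h1.symm).resolve_left (pow_ne_zero _ hx)
      simpa [titsForm] using this
    have h4 : z ^ s = 1 + z := by
      rw [← CharTwo.add_eq_zero, ← h3]; ring
    have h5 : z ^ 2 = z := by
      rw [← hss z, h4, hadd, h4, one_pow, ← add_assoc, CharTwo.add_self_eq_zero, zero_add]
    have h6 : z * (z - 1) = 0 := by linear_combination h5
    rcases mul_eq_zero.1 h6 with h7 | h7
    · simp [h7, hs] at h4
    · rw [sub_eq_zero.1 h7, one_pow, CharTwo.add_self_eq_zero] at h4
      exact one_ne_zero h4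

variable [Finite F]

/-- Scaling permutes the nonzero fibres transitively, and the zero fibre is a single point. -/
theorem titsForm_hasEllipticFibres (hs : s ≠ 0)
    (hadd : ∀ x y : F, (x + y) ^ s = x ^ s + y ^ s) (hss : ∀ x : F, (x ^ s) ^ s = x ^ 2) :
    HasEllipticFibres (Nat.card F) 1 (titsForm (F := F) s) := by
  classical
  have := Fintype.ofFinite F
  have h0 : Nat.card {p : F × F // titsForm s p = 0} = 1 := by
    rw [Nat.card_eq_one_iff_exists]
    refine ⟨⟨0, (titsForm_eq_zero_iff hs hadd hss 0).2 rfl⟩, fun p => Subtype.ext ?_⟩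
    exact (titsForm_eq_zero_iff hs hadd hss _).1 p.2
  have ht : ∀ t : F, t ≠ 0 → Nat.card {p : F × F // titsForm s p = t}
      = Nat.card {p : F × F // titsForm s p = 1} := by
    intro t ht
    obtain ⟨l, hl⟩ := Finite.surjective_of_injective (pow_add_two_injective hss) t
    simp only at hl
    have hl0 : l ≠ 0 := by
      rintro rfl
      rw [zero_pow (by omega)] at hl
      exact ht hl.symm
    refine (Nat.card_congr (((Equiv.mulLeft₀ l hl0).prodCongr
      (Equiv.mulLeft₀ (l ^ (s + 1)) (pow_ne_zero _ hl0))).subtypeEquiv fun p => ?_)).symm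
    change _ ↔ titsForm s (l * p.1, l ^ (s + 1) * p.2) = t
    rw [titsForm_scale hss, hl]
    exact (mul_eq_left₀ ht).symm
  have hsum : Nat.card (F × F) = ∑ t : F, Nat.card {p : F × F // titsForm s p = t} := by
    rw [← Nat.card_sigma]
    exact Nat.card_congr (Equiv.sigmaFiberEquiv _).symm
  rw [Nat.card_prod, ← Finset.add_sum_erase _ _ (Finset.mem_univ (0 : F)), h0,
    Finset.sum_congr rfl fun t h => ht t (Finset.ne_of_mem_erase h), Finset.sum_const,
    Finset.card_erase_of_mem (Finset.mem_univ _), Finset.card_univ, ← Nat.card_eq_fintype_card,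
    smul_eq_mul] at hsum
  have hq : 1 < Nat.card F := Finite.one_lt_card
  have h1 : (Nat.card {p : F × F // titsForm s p = 1} : ℤ) = Nat.card F + 1 := by
    obtain ⟨k, hk⟩ : ∃ k, Nat.card F = k + 1 + 1 := ⟨Nat.card F - 2, by omega⟩
    rw [hk] at hsum ⊢
    have h3 : (k + 1) * Nat.card {p : F × F // titsForm s p = 1} = (k + 1) * (k + 1 + 1 + 1) := by
      have : k + 1 + 1 - 1 = k + 1 := rfl
      rw [this] at hsum
      linarith
    exact_mod_cast Nat.eq_of_mul_eq_mul_left (Nat.succ_pos k) h3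
  refine ⟨0, fun t => ?_⟩
  split_ifs with h
  · rw [h, h0]; push_cast; ring
  · rw [ht t h, h1]; ring

/-- Adding a linear function to the Tits form does not change the fibre sizes: the graph is an
ovoid, so a plane off the point at infinity meets it in `1` or `q + 1` points. -/
theorem titsForm_add_linear_hasEllipticFibres (hs : s ≠ 0)
    (hadd : ∀ x y : F, (x + y) ^ s = x ^ s + y ^ s) (hss : ∀ x : F, (x ^ s) ^ s = x ^ 2)
    (a b : F) :
    HasEllipticFibres (Nat.card F) 1 (fun p : F × F => titsForm s p + (a * p.1 + b * p.2)) := by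
  set c := a + b ^ (s + 1) with hc
  have hinv : Function.Bijective fun p : F × F => (p.1 + b, p.2 + c + b ^ s * p.1) := by
    rw [← Finite.injective_iff_bijective]
    rintro ⟨x, y⟩ ⟨x', y'⟩ h
    simp only [Prod.mk.injEq] at h
    obtain ⟨h1, h2⟩ := h
    have h3 := add_right_cancel h1
    subst h3
    simpa using h2
  have h := ((titsForm_hasEllipticFibres hs hadd hss).comp_equiv
    (Equiv.ofBijective _ hinv)).add_const (titsForm s (b, c))
  convert h using 2 with p
  simp only [Function.comp, Equiv.ofBijective_apply]
  rw [titsForm_shear hadd hss, hc]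
  have h2 : (2 : F) = 0 := CharTwo.two_eq_zero
  linear_combination (-titsForm s (b, a + b ^ (s + 1)) - b ^ (s + 1) * p.1) * h2

end Tits

/-! ### Coordinates in the quadratic extension -/

section Coordinates

variable {F K : Type*} [Field F] [Finite F] [Field K] [Algebra F K]

/-- A root of `X ^ q - X` lies in the field with `q` elements. -/
theorem mem_range_algebraMap_of_pow_card {x : K} (hx : x ^ Nat.card F = x) :
    x ∈ Set.range (algebraMap F K) := by
  classical
  have := Fintype.ofFinite F
  by_contra hn
  have hq : 1 < Fintype.card F := Fintype.one_lt_card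
  have hne := FiniteField.X_pow_card_sub_X_ne_zero K hq
  have hsub : insert x (Finset.univ.map ⟨algebraMap F K, (algebraMap F K).injective⟩) ⊆
      (Polynomial.X ^ Fintype.card F - Polynomial.X : Polynomial K).roots.toFinset := by
    intro y hy
    rw [Multiset.mem_toFinset, Polynomial.mem_roots hne, Polynomial.IsRoot.def]
    rcases Finset.mem_insert.1 hy with rfl | hy
    · simpa [sub_eq_zero, Nat.card_eq_fintype_card] using hx
    · obtain ⟨u, -, rfl⟩ := Finset.mem_map.1 hy
      simp [← map_pow, FiniteField.pow_card]
  have h1 := (Finset.card_le_card hsub).trans (Multiset.toFinset_card_le _) |>.trans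
    (Polynomial.card_roots' _)
  rw [FiniteField.X_pow_card_sub_X_natDegree_eq K hq,
    Finset.card_insert_of_notMem (by simpa using hn), Finset.card_map, Finset.card_univ] at h1
  omega

/-- The two roots of `X ^ 2 + X + δ` are exchanged by the Frobenius map over `F`. -/
theorem pow_card_eq_add_one [CharP F 2] (ε : K) (hε : ε ∉ Set.range (algebraMap F K)) (δ : F)
    (hδ : ε ^ 2 + ε + algebraMap F K δ = 0) : ε ^ Nat.card F = ε + 1 := by
  have := Fintype.ofFinite F
  have : CharP K 2 := charP_of_injective_algebraMap (algebraMap F K).injective 2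
  have h2 : (2 : K) = 0 := CharTwo.two_eq_zero
  have h1 : (ε ^ Nat.card F) ^ 2 + ε ^ Nat.card F + algebraMap F K δ = 0 := by
    have h := congrArg (FiniteField.frobeniusAlgHom F K) hδ
    simpa only [map_add, map_pow, AlgHom.commutes, map_zero, FiniteField.coe_frobeniusAlgHom,
      Nat.card_eq_fintype_card] using h
  have h3 : (ε ^ Nat.card F - ε) * (ε ^ Nat.card F - (ε + 1)) = 0 := by
    linear_combination h1 - hδ + (ε ^ 2 - ε ^ Nat.card F * ε - ε ^ Nat.card F + ε) * h2
  rcases mul_eq_zero.1 h3 with h | h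
  · exact absurd (mem_range_algebraMap_of_pow_card (sub_eq_zero.1 h)) hε
  · exact sub_eq_zero.1 h

variable [Finite K]

/-- The coordinates `(u, v)` of `u + v * ε`, for a generator `ε` of the quadratic extension. -/
noncomputable def coordEquiv (hK : Nat.card K = Nat.card F ^ 2) (ε : K)
    (hε : ε ∉ Set.range (algebraMap F K)) : F × F ≃ K :=
  Equiv.ofBijective (fun p => algebraMap F K p.1 + algebraMap F K p.2 * ε) <| by
    rw [Nat.bijective_iff_injective_and_card]
    refine ⟨?_, by rw [Nat.card_prod, hK, sq]⟩
    rintro ⟨u, v⟩ ⟨u', v'⟩ h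
    simp only at h
    by_cases hv : v = v'
    · subst hv
      simpa using h
    · refine absurd ⟨(u - u') / (v' - v), ?_⟩ hε
      have h0 : algebraMap F K v' - algebraMap F K v ≠ 0 := by
        rw [← map_sub, Ne, map_eq_zero_iff _ (algebraMap F K).injective, sub_eq_zero]
        exact fun h => hv h.symm
      rw [map_div₀, map_sub, map_sub, div_eq_iff h0]
      linear_combination h

variable {hK : Nat.card K = Nat.card F ^ 2} {ε : K} {hε : ε ∉ Set.range (algebraMap F K)}

omit [Finite F] in
theorem coordEquiv_apply (p : F × F) :
    coordEquiv hK ε hε p = algebraMap F K p.1 + algebraMap F K p.2 * ε := rfl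

variable [CharP F 2] {δ : F}

theorem coordEquiv_pow_card (hδ : ε ^ 2 + ε + algebraMap F K δ = 0) (p : F × F) :
    coordEquiv hK ε hε p ^ Nat.card F =
      algebraMap F K p.1 + algebraMap F K p.2 * (ε + 1) := by
  have := Fintype.ofFinite F
  have h := congrArg (FiniteField.frobeniusAlgHom F K) (coordEquiv_apply (hK := hK) (hε := hε) p)
  simp only [map_add, map_mul, AlgHom.commutes, FiniteField.coe_frobeniusAlgHom,
    ← Nat.card_eq_fintype_card, pow_card_eq_add_one ε hε δ hδ] at h
  exact h

theorem coordEquiv_trace (hδ : ε ^ 2 + ε + algebraMap F K δ = 0) (p : F × F) :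
    coordEquiv hK ε hε p ^ Nat.card F + coordEquiv hK ε hε p = algebraMap F K p.2 := by
  have : CharP K 2 := charP_of_injective_algebraMap (algebraMap F K).injective 2
  have h2 : (2 : K) = 0 := CharTwo.two_eq_zero
  rw [coordEquiv_pow_card hδ, coordEquiv_apply]
  linear_combination (algebraMap F K p.1 + algebraMap F K p.2 * ε) * h2

/-- In coordinates, `Γ_ε` is the Tits form; in particular its values lie in the subfield. -/
theorem Gam_coordEquiv {e : ℕ} (he : Nat.card F = 2 ^ e)
    (hδ : ε ^ 2 + ε + algebraMap F K δ = 0) (p : F × F) :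
    Gam e ε (coordEquiv hK ε hε p) = algebraMap F K (titsForm (2 ^ ((e + 1) / 2)) p) := by
  have : CharP K 2 := charP_of_injective_algebraMap (algebraMap F K).injective 2
  have h2 : (2 : K) = 0 := CharTwo.two_eq_zero
  have ht := coordEquiv_trace (hK := hK) (hε := hε) hδ p
  have hp := coordEquiv_pow_card (hK := hK) (hε := hε) hδ p
  rw [he] at ht hp
  have h0 : coordEquiv hK ε hε p + algebraMap F K p.2 * ε = algebraMap F K p.1 := by
    rw [coordEquiv_apply]
    linear_combination algebraMap F K p.2 * ε * h2
  rw [Gam, ht, mul_comm 2, pow_mul, pow_succ _ (2 ^ e), Algebra.algebraMap_self,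
    RingHom.id_apply, h0, hp, coordEquiv_apply]
  simp only [titsForm, map_add, map_mul, map_pow]
  generalize algebraMap F K p.1 = u
  generalize algebraMap F K p.2 = v
  linear_combination
    ((ε + 1) * (u + v * ε) ^ 2 + ε * v * (u + v * ε) + v ^ 2 * ε) * h2

/-- The function `x ↦ Γ_ε(x) + Tr(a * x)` takes values in the subfield, and has the same fibre
sizes as the Tits form. -/
theorem exists_hasEllipticFibres_Gam_add_trace {e : ℕ} (heo : Odd e) (he : Nat.card F = 2 ^ e)
    (hK : Nat.card K = Nat.card F ^ 2) (hε : ε ∉ Set.range (algebraMap F K))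
    (hδ : ε ^ 2 + ε + algebraMap F K δ = 0) (a : K) :
    ∃ g : K → F, HasEllipticFibres (2 ^ e) 1 g ∧
      ∀ x, algebraMap F K (g x) = Gam e ε x + ((a * x) ^ 2 ^ e + a * x) := by
  have := Fintype.ofFinite F
  have hs : (2 : ℕ) ^ ((e + 1) / 2) ≠ 0 := by positivity
  have hadd : ∀ x y : F, (x + y) ^ 2 ^ ((e + 1) / 2) =
    x ^ 2 ^ ((e + 1) / 2) + y ^ 2 ^ ((e + 1) / 2) := fun x y => add_pow_char_pow x y 2 _
  have hss : ∀ x : F, (x ^ 2 ^ ((e + 1) / 2)) ^ 2 ^ ((e + 1) / 2) = x ^ 2 := by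
    intro x
    obtain ⟨k, rfl⟩ := heo
    have h : (2 * k + 1 + 1) / 2 + (2 * k + 1 + 1) / 2 = 2 * k + 1 + 1 := by omega
    rw [← pow_mul, ← pow_add, h, pow_succ, ← he, pow_mul, Nat.card_eq_fintype_card,
      FiniteField.pow_card]
  obtain ⟨⟨a0, a1⟩, rfl⟩ := (coordEquiv hK ε hε).surjective a
  have h := (titsForm_add_linear_hasEllipticFibres hs hadd hss a1 (a0 + a1)).comp_equiv
    (coordEquiv hK ε hε).symm
  rw [he] at h
  refine ⟨_, h, fun x => ?_⟩
  obtain ⟨p, rfl⟩ := (coordEquiv hK ε hε).surjective x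
  have hmul : coordEquiv hK ε hε (a0, a1) * coordEquiv hK ε hε p =
      coordEquiv hK ε hε (a0 * p.1 - a1 * p.2 * δ, a1 * p.1 + (a0 - a1) * p.2) := by
    simp only [coordEquiv_apply, map_add, map_sub, map_mul]
    linear_combination algebraMap F K a1 * algebraMap F K p.2 * hδ
  rw [hmul, ← he, coordEquiv_trace hδ, Gam_coordEquiv he hδ]
  simp [CharTwo.sub_eq_add]

theorem card_trace_fibre (hK : Nat.card K = Nat.card F ^ 2) (hε : ε ∉ Set.range (algebraMap F K))
    (hδ : ε ^ 2 + ε + algebraMap F K δ = 0) (t : F) :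
    Nat.card {z : K // z ^ Nat.card F + z = algebraMap F K t} = Nat.card F := by
  rw [← Nat.card_congr ((coordEquiv hK ε hε).subtypeEquiv (p := fun p => p.2 = t) fun p => by
    rw [coordEquiv_trace hδ, (algebraMap F K).injective.eq_iff])]
  exact Nat.card_congr
    { toFun := fun p => p.1.1
      invFun := fun u => ⟨(u, t), rfl⟩
      left_inv := by rintro ⟨⟨u, v⟩, rfl⟩; rfl
      right_inv := fun _ => rfl }

end Coordinates

/-! ### Counting affine points of the variety -/

section Points

variable {F K : Type*} [Field F] [Finite F] [CharP F 2] [Field K] [Finite K] [Algebra F K]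
  {ε : K} {δ : F} {e m : ℕ}

/-- The pairs `((x₁, …, x_m), z)` for which `(1, x₁, …, x_m, z)` lies on the variety. -/
def affineSolutions (e : ℕ) (ε : K) (m : ℕ) : Set ((Fin m → K) × K) :=
  {p | p.2 ^ 2 ^ e + p.2 = ∑ i, Gam e ε (p.1 i)}

theorem Gam_mem_range (heo : Odd e) (he : Nat.card F = 2 ^ e) (hK : Nat.card K = Nat.card F ^ 2)
    (hε : ε ∉ Set.range (algebraMap F K)) (hδ : ε ^ 2 + ε + algebraMap F K δ = 0) (x : K) :
    ∃ u, algebraMap F K u = Gam e ε x := by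
  obtain ⟨g, -, hg⟩ := exists_hasEllipticFibres_Gam_add_trace heo he hK hε hδ 0
  exact ⟨g x, by simp [hg]⟩

/-- Above every `(x₁, …, x_m)` lie `q` points of the variety. -/
theorem ncard_affineSolutions_inter (heo : Odd e) (he : Nat.card F = 2 ^ e)
    (hK : Nat.card K = Nat.card F ^ 2) (hε : ε ∉ Set.range (algebraMap F K))
    (hδ : ε ^ 2 + ε + algebraMap F K δ = 0) (P : (Fin m → K) → Prop) :
    {p ∈ affineSolutions e ε m | P p.1}.ncard = Nat.card {x // P x} * 2 ^ e := by
  have := Fintype.ofFinite {x // P x}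
  choose g hg using Gam_mem_range heo he hK hε hδ
  have h : {p ∈ affineSolutions e ε m | P p.1} ≃
      Σ x : {x // P x}, {z : K // z ^ Nat.card F + z = algebraMap F K (∑ i, g (x.1 i))} :=
    { toFun := fun p => ⟨⟨p.1.1, p.2.2⟩, p.1.2, by
        simpa [hg, he, affineSolutions] using p.2.1⟩
      invFun := fun p => ⟨(p.1.1, p.2.1), by
        simpa [hg, he, affineSolutions] using p.2.2, p.1.2⟩
      left_inv := fun _ => rfl
      right_inv := fun _ => rfl }
  rw [← Nat.card_coe_set_eq, Nat.card_congr h, Nat.card_sigma]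
  simp only [card_trace_fibre hK hε hδ]
  simp [he, Nat.card_eq_fintype_card]

/-- A nonzero linear form takes each value equally often. -/
theorem card_linear_fibre (c : Fin m → K) (hc : c ≠ 0) (t : K) :
    Nat.card {x : Fin m → K // t + ∑ i, c i * x i = 0} * Nat.card K = Nat.card K ^ m := by
  classical
  have := Fintype.ofFinite K
  obtain ⟨k, hk⟩ := Function.ne_iff.1 hc
  let f : (Fin m → K) →+ K :=
    { toFun := fun x => ∑ i, c i * x i
      map_zero' := by simp
      map_add' := fun x y => by simp [mul_add, Finset.sum_add_distrib] }
  have hf : ∀ y, y ∈ Set.range f := fun y => by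
    refine ⟨Pi.single k (y / c k), ?_⟩
    change ∑ i, c i * (Pi.single k (y / c k) : Fin m → K) i = y
    rw [Finset.sum_eq_single k]
    · rw [Pi.single_eq_same, mul_div_cancel₀ _ hk]
    · intro i _ hi; rw [Pi.single_eq_of_ne hi, mul_zero]
    · simp
  have hsum : Nat.card (Fin m → K) = ∑ y : K, Nat.card {x // f x = y} := by
    rw [← Nat.card_sigma]
    exact Nat.card_congr (Equiv.sigmaFiberEquiv f).symm
  have hcst : ∀ y, Nat.card {x // f x = y} = Nat.card {x // f x = -t} := fun y => by
    simp only [Nat.card_eq_fintype_card, Fintype.card_subtype]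
    exact AddMonoidHom.card_fiber_eq_of_mem_range f (hf _) (hf _)
  rw [Finset.sum_congr rfl fun y _ => hcst y, Nat.card_fun, Nat.card_fin] at hsum
  rw [hsum, Finset.sum_const, Finset.card_univ, smul_eq_mul, mul_comm,
    Nat.card_eq_fintype_card (α := K)]
  congr 1
  refine Nat.card_congr (Equiv.subtypeEquivRight fun x => ?_)
  rw [add_comm, add_eq_zero_iff_eq_neg]
  rfl

/-- The number of affine points of the variety in a hyperplane off `P_∞`, here
`z = d + c₁ x₁ + ⋯ + c_m x_m`. For fixed `c₁, …, c_m` it depends only on the trace `t` of `d`, and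
takes an exceptional value at a single trace `T`. -/
theorem ncard_affineSolutions_graph (heo : Odd e) (he : Nat.card F = 2 ^ e)
    (hK : Nat.card K = Nat.card F ^ 2) (hε : ε ∉ Set.range (algebraMap F K))
    (hδ : ε ^ 2 + ε + algebraMap F K δ = 0) (c : Fin m → K) :
    ∃ T : F, ∀ (t : F) (d : K), d ^ 2 ^ e + d = algebraMap F K t →
      ({p ∈ affineSolutions e ε m | p.2 = d + ∑ i, c i * p.1 i}.ncard : ℤ) * 2 ^ e =
        (2 ^ e) ^ (2 * m) - (-2 ^ e) ^ m
          + open Classical in if t = T then 2 ^ e * (-2 ^ e) ^ m else 0 := by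
  have : CharP K 2 := charP_of_injective_algebraMap (algebraMap F K).injective 2
  choose g hg hgx using fun i =>
    exists_hasEllipticFibres_Gam_add_trace heo he hK hε hδ (c i)
  obtain ⟨T, hT⟩ := hasEllipticFibres_sum_pi (by positivity)
    (by rw [hK, he]) m g hg
  refine ⟨T, fun t d hd => ?_⟩
  have hT' := hT t
  push_cast at hT'
  rw [← hT']
  congr 2
  rw [← Nat.card_coe_set_eq]
  have key : ∀ x : Fin m → K, (∑ i, g i (x i) = t) ↔
      (d + ∑ i, c i * x i) ^ 2 ^ e + (d + ∑ i, c i * x i) = ∑ i, Gam e ε (x i) := by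
    intro x
    rw [← (algebraMap F K).injective.eq_iff, ← hd, map_sum]
    simp only [hgx, Finset.sum_add_distrib]
    rw [← sum_pow_char_pow 2, add_pow_char_pow _ _ 2]
    have h2 : (2 : K) = 0 := CharTwo.two_eq_zero
    constructor <;> intro h <;>
      linear_combination -h + ((∑ i, c i * x i) ^ 2 ^ e + ∑ i, c i * x i) * h2
  refine Nat.card_congr
    { toFun := fun p => ⟨p.1.1, (key _).2 ?_⟩
      invFun := fun x => ⟨(x.1, d + ∑ i, c i * x.1 i), (key _).1 x.2, rfl⟩
      left_inv := ?_
      right_inv := fun _ => rfl }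
  · rw [← p.2.2]; exact p.2.1
  · rintro ⟨⟨x, z⟩, h1, h2⟩
    exact Subtype.ext (Prod.ext rfl h2.symm)

/-- The number of affine points of the variety on a hyperplane `c₀ + c₁ x₁ + ⋯ + c_m x_m = 0`
through `P_∞`. -/
theorem ncard_affineSolutions_cylinder (heo : Odd e) (he : Nat.card F = 2 ^ e)
    (hK : Nat.card K = Nat.card F ^ 2) (hε : ε ∉ Set.range (algebraMap F K))
    (hδ : ε ^ 2 + ε + algebraMap F K δ = 0) (c : Fin m → K) (hc : c ≠ 0) (d : K) :
    {p ∈ affineSolutions e ε m | d + ∑ i, c i * p.1 i = 0}.ncard * (2 ^ e) ^ 2 =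
      (2 ^ e) ^ (2 * m + 1) := by
  rw [ncard_affineSolutions_inter heo he hK hε hδ (fun x => d + ∑ i, c i * x i = 0),
    mul_right_comm, ← he, ← hK, card_linear_fibre c hc, hK, ← pow_mul, pow_succ]

theorem ncard_affineSolutions (heo : Odd e) (he : Nat.card F = 2 ^ e)
    (hK : Nat.card K = Nat.card F ^ 2) (hε : ε ∉ Set.range (algebraMap F K))
    (hδ : ε ^ 2 + ε + algebraMap F K δ = 0) :
    (affineSolutions e ε m).ncard = (2 ^ e) ^ (2 * m + 1) := by
  have h := ncard_affineSolutions_inter (m := m) heo he hK hε hδ (fun _ => True)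
  simp only [and_true, Set.ofPred_mem_eq] at h
  rw [h, Nat.card_congr (Equiv.subtypeUnivEquiv fun _ => trivial), Nat.card_fun, Nat.card_fin, hK,
    he, ← pow_mul, pow_succ]

end Points

/-! ### Codewords and points of the multiset -/

section Codewords

variable {K : Type*} [Field K]

/-- The vector `(1, x₁, …, x_m, z)`. -/
def affineVec {m : ℕ} (p : (Fin m → K) × K) : Fin (m + 1 + 1) → K :=
  Fin.cons 1 (Fin.snoc p.1 p.2)

theorem affineVec_ne_zero {m : ℕ} (p : (Fin m → K) × K) : affineVec p ≠ 0 := fun h => by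
  have := congrFun h 0
  simp [affineVec] at this

theorem dotProduct_affineVec {m : ℕ} (c : Fin (m + 1 + 1) → K) (p : (Fin m → K) × K) :
    c ⬝ᵥ affineVec p =
      c 0 + (∑ i : Fin m, c i.castSucc.succ * p.1 i + c (Fin.last _) * p.2) := by
  simp [dotProduct, Fin.sum_univ_succ (n := m + 1), Fin.sum_univ_castSucc (n := m), affineVec]

theorem sum_Ioo_zero_last {M : Type*} [AddCommMonoid M] {m : ℕ} (f : Fin (m + 1 + 1) → M) :
    ∑ i ∈ Finset.Ioo 0 (Fin.last (m + 1)), f i = ∑ i : Fin m, f i.castSucc.succ := by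
  have h : Finset.Ioo 0 (Fin.last (m + 1)) =
      Finset.univ.filter fun i => 0 < i ∧ i < Fin.last _ := by
    ext; simp
  rw [h, Finset.sum_filter, Fin.sum_univ_succ, Fin.sum_univ_castSucc]
  simp [Fin.succ_castSucc, Fin.castSucc_lt_last, -Fin.castSucc_succ]

theorem V_diff_hyperplaneAtInfinity (m e : ℕ) (ε : K) :
    V (m + 1) e ε \ hyperplaneAtInfinity K (m + 1) =
      (fun p => Projectivization.mk K (affineVec p) (affineVec_ne_zero p)) ''
        affineSolutions e ε m := by
  have hV : ∀ p : (Fin m → K) × K,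
      Projectivization.mk K (affineVec p) (affineVec_ne_zero p) ∈ V (m + 1) e ε ↔
        p ∈ affineSolutions e ε m := fun p => by
    rw [mk_mem_V ε _ _ (by simp [affineVec]), sum_Ioo_zero_last, affineSolutions]
    have h1 : affineVec p (Fin.last (m + 1)) = p.2 := by
      simp [affineVec, -Fin.succ_last]
    have h2 : ∀ i : Fin m, affineVec p i.castSucc.succ = p.1 i := fun i => by
      simp [affineVec, -Fin.castSucc_succ]
    simp only [h1, h2]
    rfl
  ext P
  constructor
  · rintro ⟨h1, h2⟩
    have h0 : P.rep 0 ≠ 0 := h2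
    set w : Fin (m + 1 + 1) → K := (P.rep 0)⁻¹ • P.rep with hw
    have hp : affineVec (fun i : Fin m => w i.castSucc.succ, w (Fin.last _)) = w := by
      funext i
      refine Fin.cases ?_ (fun i => Fin.lastCases ?_ (fun i => ?_) i) i
      · simp [affineVec, hw, h0]
      · simp [affineVec]
      · simp [affineVec]
    have hP : Projectivization.mk K (affineVec (fun i : Fin m => w i.castSucc.succ, w (Fin.last _)))
        (affineVec_ne_zero _) = P := by
      conv_rhs => rw [← P.mk_rep]
      rw [Projectivization.mk_eq_mk_iff']
      exact ⟨(P.rep 0)⁻¹, hp.symm⟩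
    exact ⟨_, (hV _).1 (by rw [hP]; exact h1), hP⟩
  · rintro ⟨p, hp, rfl⟩
    refine ⟨(hV p).2 hp, ?_⟩
    rw [mk_mem_hyperplaneAtInfinity]
    simp [affineVec]

theorem mk_affineVec_injective (m : ℕ) : Function.Injective fun p : (Fin m → K) × K =>
    Projectivization.mk K (affineVec p) (affineVec_ne_zero p) := by
  intro p p' h
  obtain ⟨a, ha⟩ := (Projectivization.mk_eq_mk_iff' _ _ _ _ _).1 h
  have h1 : a = 1 := by simpa [affineVec] using congrFun ha 0
  subst h1
  rw [one_smul] at ha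
  have h2 := Fin.cons_injective2 ha |>.2
  have h3 := Fin.snoc_injective2 h2
  exact (Prod.ext h3.1 h3.2).symm

theorem dotProduct_rep_mk_eq_zero {r : ℕ} (c v : Fin (r + 1) → K) (hv : v ≠ 0) :
    c ⬝ᵥ (Projectivization.mk K v hv).rep = 0 ↔ c ⬝ᵥ v = 0 := by
  obtain ⟨a, ha⟩ := Projectivization.exists_smul_eq_mk_rep K v hv
  rw [← ha, Units.smul_def, dotProduct_smul, smul_eq_mul, mul_eq_zero]
  simp

variable [DecidableEq K]

/-- The zeros of a codeword are the points of the multiset on the corresponding hyperplane. -/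
theorem hammingNorm_vecMul_add_countP {r n : ℕ} (G : Matrix (Fin (r + 1)) (Fin n) K)
    (hG : ∀ i, G.col i ≠ 0) (c : Fin (r + 1) → K) :
    hammingNorm (Matrix.vecMul c G) + (Finset.univ.val.map fun i =>
      Projectivization.mk K (G.col i) (hG i)).countP (fun P => c ⬝ᵥ P.rep = 0) = n := by
  rw [Multiset.countP_map, ← Finset.filter_val, Finset.card_val, hammingNorm, add_comm]
  have h : ∀ i, c ⬝ᵥ (Projectivization.mk K (G.col i) (hG i)).rep = 0 ↔
      Matrix.vecMul c G i = 0 := fun i => dotProduct_rep_mk_eq_zero c _ _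
  simp only [h]
  rw [Finset.card_filter_add_card_filter_not]
  simp

theorem countP_Vbar [Finite K] (m e : ℕ) (ε : K) (j : ℕ) (c : Fin (m + 1 + 1) → K) :
    (Vbar (m + 1) e ε j).countP (fun P => c ⬝ᵥ P.rep = 0) =
      {p ∈ affineSolutions e ε m | c 0 + (∑ i : Fin m, c i.castSucc.succ * p.1 i
        + c (Fin.last _) * p.2) = 0}.ncard + if c (Fin.last _) = 0 then j else 0 := by
  classical
  rw [Vbar, Multiset.countP_add]
  congr 1
  · rw [Multiset.countP_eq_card_filter, ← Finset.filter_val, Finset.card_val,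
      ← Set.ncard_coe_finset, ← Set.ncard_image_of_injective _ (mk_affineVec_injective m)]
    congr 1
    ext P
    simp only [Finset.coe_filter, Set.Finite.mem_toFinset, V_diff_hyperplaneAtInfinity,
      Set.mem_ofPred_eq, Set.mem_image]
    constructor
    · rintro ⟨⟨p, hp, rfl⟩, h⟩
      rw [dotProduct_rep_mk_eq_zero, dotProduct_affineVec] at h
      exact ⟨p, ⟨hp, h⟩, rfl⟩
    · rintro ⟨p, ⟨hp, h⟩, rfl⟩
      refine ⟨⟨p, hp, rfl⟩, ?_⟩
      rw [dotProduct_rep_mk_eq_zero, dotProduct_affineVec]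
      exact h
  · have h : c ⬝ᵥ (pointAtInfinity K (m + 1)).rep = 0 ↔ c (Fin.last _) = 0 := by
      rw [pointAtInfinity, dotProduct_rep_mk_eq_zero, dotProduct_single, mul_one]
    rw [← Multiset.coe_replicate, Multiset.coe_countP, List.countP_replicate]
    simp [h]

theorem card_Vbar [Finite K] (m e : ℕ) (ε : K) (j : ℕ) :
    Multiset.card (Vbar (m + 1) e ε j) = (affineSolutions e ε m).ncard + j := by
  have h := countP_Vbar m e ε j 0
  simpa [Multiset.countP_eq_card_filter] using h

end Codewords

/-! ### Hyperplane sections of the variety -/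

section Hyperplanes

variable {F K : Type*} [Field F] [Finite F] [CharP F 2] [Field K] [Finite K] [Algebra F K]
  {ε : K} {δ : F} {e k : ℕ}

/-- The affine points of the variety on the hyperplane
`c₀ + c₁ x₁ + ⋯ + c_m x_m + c_{m+1} z = 0`. -/
def hyperplaneSection {m : ℕ} (e : ℕ) (ε : K) (c : Fin (m + 1 + 1) → K) :
    Set ((Fin m → K) × K) :=
  {p ∈ affineSolutions e ε m | c 0 + (∑ i : Fin m, c i.castSucc.succ * p.1 i
    + c (Fin.last _) * p.2) = 0}

omit [Finite K] in
theorem hyperplaneSection_of_last_ne_zero {m : ℕ} (c : Fin (m + 1 + 1) → K)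
    (hc : c (Fin.last _) ≠ 0) :
    hyperplaneSection e ε c = {p ∈ affineSolutions e ε m | p.2 = -c 0 / c (Fin.last _)
      + ∑ i : Fin m, (-c i.castSucc.succ / c (Fin.last _)) * p.1 i} := by
  ext p
  simp only [hyperplaneSection, Set.mem_ofPred_eq]
  refine and_congr_right fun _ => ?_
  simp only [div_mul_eq_mul_div, ← Finset.sum_div, neg_mul, Finset.sum_neg_distrib]
  rw [← add_div, eq_div_iff hc]
  constructor <;> intro h <;> linear_combination h

omit [Finite K] in
theorem hyperplaneSection_infinity {m : ℕ} (c : Fin (m + 1 + 1) → K) (h0 : c 0 ≠ 0)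
    (hc : ∀ i : Fin m, c i.castSucc.succ = 0) (hl : c (Fin.last _) = 0) :
    hyperplaneSection e ε c = ∅ := by
  simp [hyperplaneSection, hc, hl, h0]

theorem ncard_hyperplaneSection_of_last_eq_zero (heo : Odd e) (he : Nat.card F = 2 ^ e)
    (hK : Nat.card K = Nat.card F ^ 2) (hε : ε ∉ Set.range (algebraMap F K))
    (hδ : ε ^ 2 + ε + algebraMap F K δ = 0) (c : Fin (k + 1 + 1 + 1) → K)
    (hc : (fun i : Fin (k + 1) => c i.castSucc.succ) ≠ 0) (hl : c (Fin.last _) = 0) :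
    (hyperplaneSection e ε c).ncard = (2 ^ e) ^ (2 * k + 1) := by
  have h := ncard_affineSolutions_cylinder heo he hK hε hδ _ hc (c 0)
  simp only [hyperplaneSection, hl, zero_mul, add_zero]
  refine Nat.eq_of_mul_eq_mul_right (m := (2 ^ e) ^ 2) (by positivity) (h.trans ?_)
  ring

/-- A hyperplane off `P_∞` meets the variety in one of two numbers of affine points; when only the
constant coefficient varies, both numbers occur. -/
theorem ncard_hyperplaneSection_of_last_ne_zero (heo : Odd e) (he : Nat.card F = 2 ^ e)
    (hK : Nat.card K = Nat.card F ^ 2) (hε : ε ∉ Set.range (algebraMap F K))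
    (hδ : ε ^ 2 + ε + algebraMap F K δ = 0) {N : ℤ} :
    (∃ c : Fin (k + 1 + 1 + 1) → K, c (Fin.last _) ≠ 0 ∧ (hyperplaneSection e ε c).ncard = N) ↔
      N = (2 ^ e) ^ (2 * k + 1) - (-1) ^ (k + 1) * (2 ^ e) ^ k ∨
      N = (2 ^ e) ^ (2 * k + 1) - (-1) ^ (k + 1) * (2 ^ e) ^ k
          + (-1) ^ (k + 1) * (2 ^ e) ^ (k + 1) := by
  have hq : (2 ^ e : ℤ) ≠ 0 := by positivity
  have h1 : ((2 : ℤ) ^ e) ^ (2 * (k + 1)) - (-2 ^ e) ^ (k + 1) =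
      ((2 ^ e) ^ (2 * k + 1) - (-1) ^ (k + 1) * (2 ^ e) ^ k) * 2 ^ e := by
    rw [neg_pow]; ring
  have h2 : (2 : ℤ) ^ e * (-2 ^ e) ^ (k + 1) = (-1) ^ (k + 1) * (2 ^ e) ^ (k + 1) * 2 ^ e := by
    rw [neg_pow]; ring
  constructor
  · rintro ⟨c, hc, rfl⟩
    obtain ⟨T, hT⟩ := ncard_affineSolutions_graph heo he hK hε hδ
      (fun i : Fin (k + 1) => -c i.castSucc.succ / c (Fin.last _))
    obtain ⟨p, hp⟩ := (coordEquiv hK ε hε).surjective (-c 0 / c (Fin.last _))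
    have h := hT p.2 (-c 0 / c (Fin.last _)) (by rw [← hp, ← he]; exact coordEquiv_trace hδ p)
    rw [← hyperplaneSection_of_last_ne_zero c hc, h1, h2] at h
    split_ifs at h
    · exact Or.inr (mul_right_cancel₀ hq (h.trans (add_mul _ _ _).symm))
    · exact Or.inl (mul_right_cancel₀ hq (h.trans (add_zero _)))
  · obtain ⟨T, hT⟩ := ncard_affineSolutions_graph (m := k + 1) heo he hK hε hδ 0
    have key : ∀ t : F, ∃ c : Fin (k + 1 + 1 + 1) → K, c (Fin.last _) ≠ 0 ∧
        ((hyperplaneSection e ε c).ncard : ℤ) * 2 ^ e =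
          (2 ^ e) ^ (2 * (k + 1)) - (-2 ^ e) ^ (k + 1)
          + open Classical in if t = T then 2 ^ e * (-2 ^ e) ^ (k + 1) else 0 := by
      intro t
      set c : Fin (k + 1 + 1 + 1) → K :=
        Fin.cons (-coordEquiv hK ε hε (0, t)) (Fin.snoc (0 : Fin (k + 1) → K) 1) with hc
      have hl : c (Fin.last _) = 1 := by simp [hc, -Fin.succ_last, ← Fin.succ_last (k + 1)]
      have hm : ∀ i : Fin (k + 1), c i.castSucc.succ = 0 := fun i => by
        simp [hc, -Fin.castSucc_succ]
      have h0 : c 0 = -coordEquiv hK ε hε (0, t) := rfl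
      refine ⟨c, by simp [hl], ?_⟩
      rw [hyperplaneSection_of_last_ne_zero c (by simp [hl])]
      have h := hT t (coordEquiv hK ε hε (0, t)) (by rw [← he, coordEquiv_trace hδ])
      simpa [hl, hm, h0] using h
    rw [h1, h2] at key
    rintro (rfl | rfl)
    · obtain ⟨c, hc, h⟩ := key (T + 1)
      rw [if_neg (by simp), add_zero] at h
      exact ⟨c, hc, mul_right_cancel₀ hq h⟩
    · obtain ⟨c, hc, h⟩ := key T
      rw [if_pos rfl, ← add_mul] at h
      exact ⟨c, hc, mul_right_cancel₀ hq h⟩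

end Hyperplanes

/-! ### The weights of the code -/

section Weights

variable {F K : Type*} [Field F] [Finite F] [CharP F 2] [Field K] [Finite K] [Algebra F K]
  [DecidableEq K] {ε : K} {δ : F} {e k j n : ℕ}

/-- The weight of the codeword of a linear form is read off from the hyperplane section. -/
theorem hammingNorm_vecMul (heo : Odd e) (he : Nat.card F = 2 ^ e)
    (hK : Nat.card K = Nat.card F ^ 2) (hε : ε ∉ Set.range (algebraMap F K))
    (hδ : ε ^ 2 + ε + algebraMap F K δ = 0) {G : Matrix (Fin (k + 1 + 1 + 1)) (Fin n) K}
    (hG : ∀ i, G.col i ≠ 0)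
    (hV : (Finset.univ.val.map fun i => Projectivization.mk K (G.col i) (hG i))
      = Vbar (k + 1 + 1) e ε j) (c : Fin (k + 1 + 1 + 1) → K) :
    hammingNorm (Matrix.vecMul c G) + ((hyperplaneSection e ε c).ncard +
      if c (Fin.last _) = 0 then j else 0) = (2 ^ e) ^ (2 * k + 3) + j := by
  have h := hammingNorm_vecMul_add_countP G hG c
  have hn : n = Multiset.card (Vbar (k + 1 + 1) e ε j) := by rw [← hV]; simp
  rw [hV, countP_Vbar] at h
  rw [card_Vbar, ncard_affineSolutions heo he hK hε hδ] at hn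
  exact h.trans hn

/-- The set of weights of the words coming from nonzero linear forms. -/
theorem image_hammingNorm_vecMul (heo : Odd e) (he : Nat.card F = 2 ^ e)
    (hK : Nat.card K = Nat.card F ^ 2) (hε : ε ∉ Set.range (algebraMap F K))
    (hδ : ε ^ 2 + ε + algebraMap F K δ = 0) {G : Matrix (Fin (k + 1 + 1 + 1)) (Fin n) K}
    (hG : ∀ i, G.col i ≠ 0)
    (hV : (Finset.univ.val.map fun i => Projectivization.mk K (G.col i) (hG i))
      = Vbar (k + 1 + 1) e ε j) :
    {w : ℤ | ∃ c : Fin (k + 1 + 1 + 1) → K, c ≠ 0 ∧ (hammingNorm (Matrix.vecMul c G) : ℤ) = w} =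
      {((2 : ℤ) ^ e) ^ (2 * k + 3),
       (2 ^ e) ^ (2 * k + 3) - (2 ^ e) ^ (2 * k + 1),
       (2 ^ e) ^ (2 * k + 3) - (2 ^ e) ^ (2 * k + 1) + (-1 : ℤ) ^ (k + 1) * (2 ^ e) ^ k + (j : ℤ),
       (2 ^ e) ^ (2 * k + 3) - (2 ^ e) ^ (2 * k + 1) + (-1 : ℤ) ^ (k + 1) * (2 ^ e) ^ k
         - (-1) ^ (k + 1) * (2 ^ e) ^ (k + 1) + (j : ℤ)} := by
  have hw : ∀ c : Fin (k + 1 + 1 + 1) → K, (hammingNorm (Matrix.vecMul c G) : ℤ) =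
      (2 ^ e) ^ (2 * k + 3) + j - (hyperplaneSection e ε c).ncard
        - if c (Fin.last _) = 0 then (j : ℤ) else 0 := fun c => by
    have h : ((_ : ℕ) : ℤ) = ((_ : ℕ) : ℤ) :=
      congrArg Nat.cast (hammingNorm_vecMul heo he hK hε hδ hG hV c)
    push_cast at h
    linarith
  ext w
  simp only [Set.mem_ofPred_eq, Set.mem_insert_iff, Set.mem_singleton_iff]
  constructor
  · rintro ⟨c, hc, rfl⟩
    rw [hw c]
    by_cases hl : c (Fin.last _) = 0
    · rw [if_pos hl]
      by_cases hm : (fun i : Fin (k + 1) => c i.castSucc.succ) = 0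
      · left
        have h0 : c 0 ≠ 0 := fun h0 => hc <| by
          funext i
          refine Fin.cases h0 (fun i => Fin.lastCases ?_ (fun i => ?_) i) i
          · simpa using hl
          · exact congrFun hm i
        rw [hyperplaneSection_infinity c h0 (fun i => congrFun hm i) hl]
        simp
      · right; left
        rw [ncard_hyperplaneSection_of_last_eq_zero heo he hK hε hδ c hm hl]
        push_cast
        ring
    · right; right
      rw [if_neg hl]
      rcases (ncard_hyperplaneSection_of_last_ne_zero heo he hK hε hδ).1 ⟨c, hl, rfl⟩ with h | h
      · left; rw [h]; ring
      · right; rw [h]; ring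
  · rintro (rfl | rfl | rfl | rfl)
    -- the hyperplane at infinity
    · refine ⟨Pi.single 0 1, by simp, ?_⟩
      rw [hw, hyperplaneSection_infinity _ (by simp) (fun i => ?_) ?_]
      · simp
      · exact Pi.single_eq_of_ne Fin.last_pos.ne' _
      · exact Pi.single_eq_of_ne (Fin.succ_ne_zero _) _
    -- the hyperplane `x₁ = 0`, which passes through `P_∞`
    · refine ⟨Pi.single (Fin.castSucc 0).succ 1, by simp, ?_⟩
      have hl : (Pi.single (Fin.castSucc (0 : Fin (k + 1))).succ (1 : K) :
          Fin (k + 1 + 1 + 1) → K) (Fin.last _) = 0 := by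
        refine Pi.single_eq_of_ne ?_ _
        rw [← Fin.succ_last]
        exact fun h => (Fin.castSucc_lt_last (0 : Fin (k + 1))).ne' (Fin.succ_injective _ h)
      rw [hw, if_pos hl, ncard_hyperplaneSection_of_last_eq_zero heo he hK hε hδ _ ?_ hl]
      · push_cast
        ring
      · exact fun h => one_ne_zero (α := K) (by simpa using congrFun h 0)
    · obtain ⟨c, hc, h⟩ := (ncard_hyperplaneSection_of_last_ne_zero (k := k)
        heo he hK hε hδ).2 (Or.inl rfl)
      refine ⟨c, fun h0 => hc (by simp [h0]), ?_⟩
      rw [hw, h, if_neg hc]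
      ring
    · obtain ⟨c, hc, h⟩ := (ncard_hyperplaneSection_of_last_ne_zero (k := k)
        heo he hK hε hδ).2 (Or.inr rfl)
      refine ⟨c, fun h0 => hc (by simp [h0]), ?_⟩
      rw [hw, h, if_neg hc]
      ring

end Weights

/-- Of the four weights, the first two differ, and exactly one of the last two is new. -/
theorem isWeightCode_three {K : Type*} [Field K] [DecidableEq K] {n : ℕ}
    {C : Submodule K (Fin n → K)} {a b c d : ℤ}
    (h : (fun w : ℕ => (w : ℤ)) '' weights C = {a, b, c, d}) (hab : a ≠ b)
    (hcd : (c = a ∨ c = b) ∧ d ≠ a ∧ d ≠ b ∨ (d = a ∨ d = b) ∧ c ≠ a ∧ c ≠ b) :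
    IsWeightCode 3 C := by
  have hinj : Function.Injective fun w : ℕ => (w : ℤ) := Nat.cast_injective
  rw [IsWeightCode, ← Set.ncard_image_of_injective _ hinj, h, Set.ncard_eq_three]
  rcases hcd with ⟨hc, hda, hdb⟩ | ⟨hd, hca, hcb⟩
  · refine ⟨a, b, d, hab, hda.symm, hdb.symm, ?_⟩
    rcases hc with rfl | rfl <;> ext <;> simp only [Set.mem_insert_iff, Set.mem_singleton_iff] <;>
      tauto
  · refine ⟨a, b, c, hab, hca.symm, hcb.symm, ?_⟩
    rcases hd with rfl | rfl <;> ext <;> simp only [Set.mem_insert_iff, Set.mem_singleton_iff] <;>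
      tauto


end BTCode

theorem mainTheorem6
    (e q r j : ℕ) (he : Odd e) (hq : q = 2 ^ e) (hr : 3 ≤ r) (hj : 1 ≤ j)
    {F K : Type*} [Field F] [Fintype F] [Algebra (ZMod 2) F]
    [Field K] [Fintype K] [DecidableEq K] [Algebra F K]
    (hF : Fintype.card F = q) (hK : Fintype.card K = q ^ 2)
    (ε : K) (hε : ε ∉ Set.range (algebraMap F K))
    (hδ : ∃ δ : F, δ ≠ 1 ∧ Algebra.trace (ZMod 2) F δ = 1 ∧
      ε ^ 2 + ε + algebraMap F K δ = 0)
    {n : ℕ} (C : Submodule K (Fin n → K))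
    (hC : BTCode.IsGeneratedBy C (BTCode.Vbar r e ε j)) :
    n = q ^ (2 * r - 1) + j ∧
    Module.finrank K C = r + 1 ∧
    (fun w : ℕ => (w : ℤ)) '' BTCode.weights C =
      {(q : ℤ) ^ (2 * r - 1),
       (q : ℤ) ^ (2 * r - 1) - (q : ℤ) ^ (2 * r - 3),
       (q : ℤ) ^ (2 * r - 1) - (q : ℤ) ^ (2 * r - 3)
         + (-1) ^ (r - 1) * (q : ℤ) ^ (r - 2) + j,
       (q : ℤ) ^ (2 * r - 1) - (q : ℤ) ^ (2 * r - 3)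
         + (-1) ^ (r - 1) * (q : ℤ) ^ (r - 2) - (-1) ^ (r - 1) * (q : ℤ) ^ (r - 1) + j} ∧
    (Odd r →
      ((j : ℤ) = (q : ℤ) ^ (r - 1) - (q : ℤ) ^ (r - 2) ∨
        (j : ℤ) = (q : ℤ) ^ (2 * r - 3) - (q : ℤ) ^ (r - 2) ∨
        (j : ℤ) = (q : ℤ) ^ (2 * r - 3) + (q : ℤ) ^ (r - 1) - (q : ℤ) ^ (r - 2)) →
      BTCode.IsWeightCode 3 C) ∧
    (Even r →
      ((j : ℤ) = (q : ℤ) ^ (r - 2) ∨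
        (j : ℤ) = (q : ℤ) ^ (2 * r - 3) + (q : ℤ) ^ (r - 2) ∨
        (j : ℤ) = (q : ℤ) ^ (2 * r - 3) - (q : ℤ) ^ (r - 1) + (q : ℤ) ^ (r - 2)) →
      BTCode.IsWeightCode 3 C) := by
  obtain ⟨δ, -, -, hδ⟩ := hδ
  have : CharP F 2 := charP_of_injective_algebraMap (algebraMap (ZMod 2) F).injective 2
  obtain ⟨k, rfl⟩ : ∃ k, r = k + 1 + 1 := ⟨r - 2, by omega⟩
  have hF' : Nat.card F = 2 ^ e := by rw [Nat.card_eq_fintype_card, hF, hq]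
  have hK' : Nat.card K = Nat.card F ^ 2 := by
    rw [Nat.card_eq_fintype_card, Nat.card_eq_fintype_card, hF, hK]
  obtain ⟨G, hG, hV, rfl⟩ := hC
  have hn : n = (2 ^ e) ^ (2 * k + 3) + j := by
    have h : Multiset.card (BTCode.Vbar (k + 1 + 1) e ε j) = n := by rw [← hV]; simp
    rw [← h, BTCode.card_Vbar, BTCode.ncard_affineSolutions he hF' hK' hε hδ]
    rfl
  have hset := BTCode.image_hammingNorm_vecMul he hF' hK' hε hδ hG hV
  have hq2 : (2 : ℤ) ≤ 2 ^ e := le_self_pow₀ (by norm_num) he.pos.ne'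
  have hq0 : (0 : ℤ) < 2 ^ e := by positivity
  have hlt : ∀ a b : ℕ, a < b → ((2 : ℤ) ^ e) ^ a < (2 ^ e) ^ b := fun a b h =>
    pow_lt_pow_right₀ (by linarith) h
  have hne : ∀ c : Fin (k + 1 + 1 + 1) → K, c ≠ 0 → Matrix.vecMul c G ≠ 0 := by
    intro c hc h0
    -- no weight in the list vanishes
    have hmem : (0 : ℤ) ∈ {w : ℤ | ∃ c : Fin (k + 1 + 1 + 1) → K, c ≠ 0 ∧
        (hammingNorm (Matrix.vecMul c G) : ℤ) = w} := ⟨c, hc, by simp [h0]⟩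
    rw [hset] at hmem
    have a1 : ((2 : ℤ) ^ e) ^ (2 * k + 3) ≥ 2 * (2 ^ e) ^ (2 * k + 2) := by
      rw [pow_succ _ (2 * k + 2), mul_comm]
      exact mul_le_mul_of_nonneg_right hq2 (by positivity)
    have a2 := hlt (2 * k + 1) (2 * k + 2) (by omega)
    have a3 := hlt k (2 * k + 2) (by omega)
    have a4 := hlt (k + 1) (2 * k + 2) (by omega)
    have a5 := hlt k (k + 1) (by omega)
    have a6 : (0 : ℤ) < (2 ^ e) ^ k := by positivity
    have hj' : (1 : ℤ) ≤ j := by exact_mod_cast hj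
    simp only [Set.mem_insert_iff, Set.mem_singleton_iff] at hmem
    rcases neg_one_pow_eq_or ℤ (k + 1) with hs | hs <;> rw [hs] at hmem <;>
      rcases hmem with h | h | h | h <;> linarith
  have hinj : Function.Injective G.vecMulLinear := by
    rw [← LinearMap.ker_eq_bot, LinearMap.ker_eq_bot']
    intro c hc
    by_contra h
    exact hne c h hc
  have hspan : Submodule.span K (Set.range G.row) = LinearMap.range G.vecMulLinear :=
    (range_vecMulLinear G).symm
  have hweights : (fun w : ℕ => (w : ℤ)) '' BTCode.weights (Submodule.span K (Set.range G.row)) =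
      {w : ℤ | ∃ c : Fin (k + 1 + 1 + 1) → K, c ≠ 0 ∧
        (hammingNorm (Matrix.vecMul c G) : ℤ) = w} := by
    rw [hspan]
    ext w
    constructor
    · rintro ⟨_, ⟨_, ⟨c, rfl⟩, h0, rfl⟩, rfl⟩
      exact ⟨c, fun h => h0 (by simp [h]), rfl⟩
    · rintro ⟨c, hc, rfl⟩
      exact ⟨_, ⟨_, ⟨c, rfl⟩, hne c hc, rfl⟩, rfl⟩
  rw [hset] at hweights
  have e1 : 2 * (k + 1 + 1) - 1 = 2 * k + 3 := by omega
  have e2 : 2 * (k + 1 + 1) - 3 = 2 * k + 1 := by omega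
  have e3 : k + 1 + 1 - 1 = k + 1 := rfl
  have e4 : k + 1 + 1 - 2 = k := rfl
  rw [e1, e2, e3, e4, hq]
  push_cast
  have b1 := hlt (k + 1) (2 * k + 1) (by omega)
  have b2 : (0 : ℤ) < (2 ^ e) ^ (k + 1) := by positivity
  refine ⟨hn, ?_, hweights, fun hodd hj' => ?_, fun heven hj' => ?_⟩
  · rw [hspan, LinearMap.finrank_range_of_inj hinj, Module.finrank_fin_fun]
  · have hs : (-1 : ℤ) ^ (k + 1) = 1 := Even.neg_one_pow (by
      rcases hodd with ⟨a, ha⟩; exact ⟨a, by omega⟩)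
    rw [hs] at hweights
    refine BTCode.isWeightCode_three hweights (fun h => by linarith) ?_
    rcases hj' with hj' | hj' | hj' <;> rw [hj']
    · exact Or.inr ⟨Or.inr (by ring), fun h => by linarith, fun h => by linarith⟩
    · exact Or.inl ⟨Or.inl (by ring), fun h => by linarith, fun h => by linarith⟩
    · exact Or.inr ⟨Or.inl (by ring), fun h => by linarith, fun h => by linarith⟩
  · have hs : (-1 : ℤ) ^ (k + 1) = -1 := Odd.neg_one_pow (by
      rcases heven with ⟨a, ha⟩; exact ⟨a - 1, by omega⟩)
    rw [hs] at hweights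
    refine BTCode.isWeightCode_three hweights (fun h => by linarith) ?_
    rcases hj' with hj' | hj' | hj' <;> rw [hj']
    · exact Or.inl ⟨Or.inr (by ring), fun h => by linarith, fun h => by linarith⟩
    · exact Or.inl ⟨Or.inl (by ring), fun h => by linarith, fun h => by linarith⟩
    · exact Or.inr ⟨Or.inl (by ring), fun h => by linarith, fun h => by linarith⟩
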